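/- Let $\mathbb H$ be a separable real Banach space. For each $n\ge 1$ let $\{\mathcal F^n_t\}_{t\ge 0}$ be a right-continuous filtration on a probability space $(\Omega_n,P_n)$, let $X_n$ be an adapted càdlàg $\mathbb H$-valued process, and let $Y_n$ be an $\{\mathcal F^n_t\}$-adapted standard $\mathbb H^\#$-semimartingale. This means: for every $h\in\mathbb H$, $Y_n(h,\cdot)$ is a càdlàg real semimartingale with $Y_n(h,0)=0$; $Y_n(\sum_i a_ih_i,t)=\sum_i a_iY_n(h_i,t)$ a.s. for all finite linear combinations and all $t$; and for every $t>0$ the random variables $\sup_{s\le t}|Z_-\cdot Y_n(s)|$, $Z\in\mathcal S^n_t$, are stochastically bounded. Here $\mathcal S^n_t$ is the set of processes $Z=\sum_{k=1}^m\xi_kh_k$ with $h_k\in\mathbb H$, $\xi_k$ real, càdlàg and $\{\mathcal F^n_t\}$-adapted, and $\sup_{s\le t}\|Z(s)\|\le 1$, and $Z_-\cdot Y_n(s)=\sum_k\int_0^s\xi_k(r-)\,dY_n(h_k,r)$. Suppose $\{Y_n\}$ is uniformly exponentially tight (UET): for every $a>0$ and $t>0$ there is $k(t,a)<\infty$ with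 $$\limsup_{n\to\infty}\frac1n\sup_{Z\in\mathcal S^n_t}\log P_n\Big[\sup_{s\le t}|Z_-\cdot Y_n(s)|>k(t,a)\Big]\le -a .$$ Let $\phi_1,\phi_2,\dots$ be nonzero vectors forming a dense sequence in $\{h:\|h\|\le 1\}$, and let $p_k:\mathbb H\to\mathbb R$ be such that $h=\sum_k p_k(h)\phi_k$ for every $h\in\mathbb H$, such that $h\mapsto (p_k(h))_k$ is a homeomorphism of $\mathbb H$ onto a subset $\mathcal L$ of $\ell^1$, and such that $(p_k(h))_k$ is the only sequence $(c_k)_k\in\mathcal L$ with $h=\sum_k c_k\phi_k$. Put $\alpha=(\phi_1,\phi_2,\dots)$ and $Y_n(\alpha,\cdot)=(Y_n(\phi_1,\cdot),Y_n(\phi_2,\cdot),\dots)$, and suppose that $\{(X_n,Y_n(\alpha,\cdot))\}$ satisfies the large deviation principle (with speed $n$) in the Skorokhod space $D_{\mathbb H\times\mathbb R^\infty}[0,\infty)$ with rate function $I_\alpha$, with values in $[0,\infty]$. Let $(x,y)\in D_{\mathbb H\times\mathbb R^\infty}[0,\infty)$, $y=(y_1,y_2,\dots)$, with $I_\alpha(x,y)<\infty$.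 Then: (i) for every compact $C\subset\mathbb H$ and every $T>0$, $$\sup_{t\le T}\ \sup_{h\in C}\Big|\sum_{j=M}^{N}y_j(t)p_j(h)\Big|\to 0\quad\text{as } M,N\to\infty,$$ so that the partial sums of $\sum_j y_j(t)p_j(h)$ converge uniformly on $[0,T]\times C$; (ii) for every $t\ge 0$ the limit $\mathbf y^*(t)=\sum_j y_j(t)p_j$ is a bounded linear functional on $\mathbb H$, i.e. $\mathbf y^*(t)\in\mathbb H^*$; (iii) for every $t>0$, $\mathbf y^*$ has finite total variation on $[0,t]$ with respect to the norm of $\mathbb H^*$. -/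

import Mathlib

open MeasureTheory ProbabilityTheory Filter Topology
open scoped NNReal ENNReal Uniformity

/-- Right continuous with left limits, on the time set `[0, ∞)`. -/
def IsCadlag {E : Type*} [TopologicalSpace E] (f : ℝ≥0 → E) : Prop :=
  ∀ t, ContinuousWithinAt f (Set.Ici t) t ∧ ∃ l, Tendsto f (𝓝[<] t) (𝓝 l)

/-- The path space `D_E[0, ∞)`. -/
def CadlagPath (E : Type*) [TopologicalSpace E] : Type _ :=
  {f : ℝ≥0 → E // IsCadlag f}

/-- The Skorokhod neighbourhood of `x` given by a horizon `T`, a time tolerance `ε` and an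
entourage `V`: all paths `y` such that, for some strictly increasing bijection `θ` of `[0, ∞)`,
`|θ t - t| < ε` and `x t`, `y (θ t)` are `V`-close for all `t ≤ T`. -/
def skorokhodNhd {E : Type*} [UniformSpace E] (x : CadlagPath E) (T : ℝ≥0) (ε : ℝ)
    (V : Set (E × E)) : Set (CadlagPath E) :=
  {y | ∃ θ : ℝ≥0 ≃o ℝ≥0, ∀ t ≤ T, |(θ t : ℝ) - (t : ℝ)| < ε ∧ (x.1 t, y.1 (θ t)) ∈ V}

/-- The Skorokhod (`J₁`) topology on `D_E[0, ∞)`. -/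
instance CadlagPath.instTopologicalSpace {E : Type*} [UniformSpace E] :
    TopologicalSpace (CadlagPath E) where
  IsOpen U := ∀ x ∈ U, ∃ (T : ℝ≥0) (ε : ℝ), 0 < ε ∧ ∃ V ∈ 𝓤 E, skorokhodNhd x T ε V ⊆ U
  isOpen_univ := fun _ _ => ⟨0, 1, one_pos, Set.univ, univ_mem, Set.subset_univ _⟩
  isOpen_inter := by
    rintro A B hA hB x ⟨hxA, hxB⟩
    obtain ⟨T, ε, hε, V, hV, h⟩ := hA x hxA
    obtain ⟨T', ε', hε', V', hV', h'⟩ := hB x hxB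
    refine ⟨max T T', min ε ε', lt_min hε hε', V ∩ V', inter_mem hV hV', ?_⟩
    rintro y ⟨θ, hθ⟩
    refine ⟨h ⟨θ, fun t ht => ?_⟩, h' ⟨θ, fun t ht => ?_⟩⟩
    · have := hθ t (le_max_of_le_left ht)
      exact ⟨this.1.trans_le (min_le_left _ _), this.2.1⟩
    · have := hθ t (le_max_of_le_right ht)
      exact ⟨this.1.trans_le (min_le_right _ _), this.2.2⟩
  isOpen_sUnion := by
    rintro S hS x ⟨A, hA, hxA⟩
    obtain ⟨T, ε, hε, V, hV, h⟩ := hS A hA x hxA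
    exact ⟨T, ε, hε, V, hV, h.trans (Set.subset_sUnion_of_mem hA)⟩

lemma IsCadlag.prodMk {E G : Type*} [TopologicalSpace E] [TopologicalSpace G]
    {f : ℝ≥0 → E} {g : ℝ≥0 → G} (hf : IsCadlag f) (hg : IsCadlag g) :
    IsCadlag (fun t => (f t, g t)) := fun t =>
  ⟨(hf t).1.prodMk (hg t).1,
    ⟨((hf t).2.choose, (hg t).2.choose),
      (hf t).2.choose_spec.prodMk_nhds (hg t).2.choose_spec⟩⟩

lemma IsCadlag.pi {ι : Type*} {E : ι → Type*} [∀ i, TopologicalSpace (E i)]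
    {f : ∀ i, ℝ≥0 → E i} (hf : ∀ i, IsCadlag (f i)) : IsCadlag (fun t i => f i t) := fun t =>
  ⟨continuousWithinAt_pi.2 fun i => (hf i t).1,
    ⟨fun i => (hf i t).2.choose, tendsto_pi_nhds.2 fun i => (hf i t).2.choose_spec⟩⟩

/-- The path `t ↦ (x t, (y₀ t, y₁ t, …))` in `D_{H × ℝ^∞}[0, ∞)`. -/
def jointPath {H : Type*} [TopologicalSpace H] (x : ℝ≥0 → H) (hx : IsCadlag x)
    (y : ℕ → ℝ≥0 → ℝ) (hy : ∀ j, IsCadlag (y j)) : CadlagPath (H × (ℕ → ℝ)) :=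
  ⟨fun t => (x t, fun j => y j t), hx.prodMk (IsCadlag.pi hy)⟩

/-- The sequence of `D`-valued random elements `W n`, defined on `(Ω n, P n)`, satisfies the
large deviation principle (with speed `n`) with rate function `I`. -/
structure SatisfiesLDP {D : Type*} [TopologicalSpace D] {Ω : ℕ → Type*}
    [∀ n, MeasurableSpace (Ω n)] (P : ∀ n, Measure (Ω n)) (W : ∀ n, Ω n → D)
    (I : D → ℝ≥0∞) : Prop where
  lower : ∀ O : Set D, IsOpen O →
    -(⨅ w ∈ O, (I w : EReal)) ≤
      liminf (fun n : ℕ => (((n : ℝ)⁻¹ : ℝ) : EReal) * ENNReal.log (P n {ω | W n ω ∈ O})) atTop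
  upper : ∀ C : Set D, IsClosed C →
    limsup (fun n : ℕ => (((n : ℝ)⁻¹ : ℝ) : EReal) * ENNReal.log (P n {ω | W n ω ∈ C})) atTop ≤
      -(⨅ w ∈ C, (I w : EReal))

/-- `sup_{s ≤ t} |J s|`. -/
noncomputable def runningSup {Ω : Type*} (J : ℝ≥0 → Ω → ℝ) (t : ℝ≥0) (ω : Ω) : ℝ≥0∞ :=
  ⨆ s ≤ t, ‖J s ω‖ₑ

/-- A real semimartingale: the sum of a local martingale and of an adapted process of locally
finite variation, both with càdlàg paths almost surely. -/
def IsSemimartingale {Ω : Type*} {mΩ : MeasurableSpace Ω} (P : Measure Ω)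
    (F : Filtration ℝ≥0 mΩ) (V : ℝ≥0 → Ω → ℝ) : Prop :=
  StronglyAdapted F V ∧ ∃ M A : ℝ≥0 → Ω → ℝ,
    Locally (fun N => Martingale N F P) F M P ∧ (∀ᵐ ω ∂P, IsCadlag fun t => M t ω) ∧
    StronglyAdapted F A ∧
    (∀ᵐ ω ∂P, IsCadlag (fun t => A t ω) ∧
      LocallyBoundedVariationOn (fun t => A t ω) Set.univ) ∧
    ∀ᵐ ω ∂P, ∀ t, V t ω = M t ω + A t ω

/-- `0 = π 0 ≤ π 1 ≤ π 2 ≤ …`, tending to infinity, with steps at most `δ`. -/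
structure IsTimePartition (π : ℕ → ℝ≥0) (δ : ℝ≥0) : Prop where
  zero : π 0 = 0
  mono : Monotone π
  tendsto : Tendsto π atTop atTop
  mesh : ∀ i, π (i + 1) ≤ π i + δ

/-- The sum `∑ᵢ ξ(πᵢ) (V(πᵢ₊₁ ∧ t) - V(πᵢ ∧ t))`; only finitely many terms are nonzero when `π` is
a time partition. -/
noncomputable def riemannSum {Ω : Type*} (π : ℕ → ℝ≥0) (ξ V : ℝ≥0 → Ω → ℝ)
    (t : ℝ≥0) (ω : Ω) : ℝ :=
  ∑' i, ξ (π i) ω * (V (min (π (i + 1)) t) ω - V (min (π i) t) ω)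

/-- `J` is (a version of) the stochastic integral `t ↦ ∫₀ᵗ ξ(s-) dV(s)` of a càdlàg adapted `ξ`
against a semimartingale `V`: the limit, uniformly on compact time sets in probability, of the
sums over deterministic partitions as their mesh tends to zero. This limit exists for every such
pair, and it determines `J` up to indistinguishability. -/
def IsStochIntegral {Ω : Type*} {mΩ : MeasurableSpace Ω} (P : Measure Ω)
    (ξ V J : ℝ≥0 → Ω → ℝ) : Prop :=
  ∀ (T : ℝ≥0) (η ε : ℝ≥0∞), 0 < η → 0 < ε → ∃ δ : ℝ≥0, 0 < δ ∧
    ∀ π : ℕ → ℝ≥0, IsTimePartition π δ →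
      P {ω | η < runningSup (fun s ω => riemannSum π ξ V s ω - J s ω) T ω} ≤ ε

/-- The data of a simple `H`-valued process `Z t = ∑ₖ ξₖ(t) hₖ` with real càdlàg adapted `ξₖ`. -/
structure SimpleProcess {Ω : Type*} {mΩ : MeasurableSpace Ω} (F : Filtration ℝ≥0 mΩ)
    (H : Type*) where
  m : ℕ
  ξ : Fin m → ℝ≥0 → Ω → ℝ
  h : Fin m → H
  adapted : ∀ k, StronglyAdapted F (ξ k)
  cadlag : ∀ k ω, IsCadlag fun t => ξ k t ω

namespace SimpleProcess

variable {Ω : Type*} {mΩ : MeasurableSpace Ω} {F : Filtration ℝ≥0 mΩ} {H : Type*}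

/-- The process `Z t = ∑ₖ ξₖ(t) hₖ`. -/
def eval [AddCommMonoid H] [Module ℝ H] (Z : SimpleProcess F H) (t : ℝ≥0) (ω : Ω) : H :=
  ∑ k, Z.ξ k t ω • Z.h k

/-- `sup_{s ≤ t} ‖Z s‖ ≤ 1`. -/
def UnitBoundedUpTo [NormedAddCommGroup H] [NormedSpace ℝ H] (Z : SimpleProcess F H)
    (t : ℝ≥0) : Prop :=
  ∀ ω, ∀ s ≤ t, ‖Z.eval s ω‖ ≤ 1

/-- `J` is (a version of) `Z₋ · Y = ∑ₖ ∫ ξₖ(s-) dY(hₖ, s)`. -/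
def IsIntegral (Z : SimpleProcess F H) (P : Measure Ω) (Y : H → ℝ≥0 → Ω → ℝ)
    (J : ℝ≥0 → Ω → ℝ) : Prop :=
  ∃ K : Fin Z.m → ℝ≥0 → Ω → ℝ, (∀ k, IsStochIntegral P (Z.ξ k) (Y (Z.h k)) (K k)) ∧
    ∀ t ω, J t ω = ∑ k, K k t ω

end SimpleProcess

/-- `Y` is an `H^#`-semimartingale with respect to the filtration `F`. -/
structure IsHSharpSemimartingale {Ω : Type*} {mΩ : MeasurableSpace Ω} (P : Measure Ω)
    (F : Filtration ℝ≥0 mΩ) {H : Type*} [AddCommMonoid H] [Module ℝ H]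
    (Y : H → ℝ≥0 → Ω → ℝ) : Prop where
  semimartingale : ∀ h, IsSemimartingale P F (Y h)
  cadlag : ∀ h ω, IsCadlag fun t => Y h t ω
  zero : ∀ h, ∀ᵐ ω ∂P, Y h 0 ω = 0
  linear : ∀ (t : ℝ≥0) (m : ℕ) (a : Fin m → ℝ) (h : Fin m → H),
    ∀ᵐ ω ∂P, Y (∑ i, a i • h i) t ω = ∑ i, a i * Y (h i) t ω

/-- An `H^#`-semimartingale is standard if, for each `t > 0`, the variables
`sup_{s ≤ t} |Z₋ · Y (s)|`, with `Z` simple and `sup_{s ≤ t} ‖Z s‖ ≤ 1`, are stochastically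
bounded. -/
structure IsStandardHSharpSemimartingale {Ω : Type*} {mΩ : MeasurableSpace Ω} (P : Measure Ω)
    (F : Filtration ℝ≥0 mΩ) {H : Type*} [NormedAddCommGroup H] [NormedSpace ℝ H]
    (Y : H → ℝ≥0 → Ω → ℝ) : Prop extends IsHSharpSemimartingale P F Y where
  standard : ∀ t : ℝ≥0, 0 < t → ∀ ε : ℝ≥0∞, 0 < ε → ∃ k : ℝ≥0,
    ∀ Z : SimpleProcess F H, Z.UnitBoundedUpTo t → ∀ J : ℝ≥0 → Ω → ℝ, Z.IsIntegral P Y J →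
      P {ω | (k : ℝ≥0∞) ≤ runningSup J t ω} ≤ ε

/-- A uniformly exponentially tight sequence of standard `H^#`-semimartingales. -/
structure IsUniformlyExponentiallyTight {Ω : ℕ → Type*} [mΩ : ∀ n, MeasurableSpace (Ω n)]
    (P : ∀ n, Measure (Ω n)) (F : ∀ n, Filtration ℝ≥0 (mΩ n))
    {H : Type*} [NormedAddCommGroup H] [NormedSpace ℝ H]
    (Y : ∀ n, H → ℝ≥0 → Ω n → ℝ) : Prop where
  standard : ∀ n, IsStandardHSharpSemimartingale (P n) (F n) (Y n)
  tight : ∀ (a : ℝ) (t : ℝ≥0), 0 < a → 0 < t → ∃ k : ℝ≥0,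
    limsup (fun n : ℕ => (((n : ℝ)⁻¹ : ℝ) : EReal) *
      ⨆ (Z : SimpleProcess (F n) H) (_ : Z.UnitBoundedUpTo t)
        (J : ℝ≥0 → Ω n → ℝ) (_ : Z.IsIntegral (P n) (Y n) J),
        ENNReal.log (P n {ω | (k : ℝ≥0∞) < runningSup J t ω})) atTop ≤ ((-a : ℝ) : EReal)

/-- The series `∑ₖ cₖ φₖ` converges to `x`. -/
def SeriesConvergesTo {H : Type*} [NormedAddCommGroup H] [NormedSpace ℝ H]
    (φ : ℕ → H) (c : ℕ → ℝ) (x : H) : Prop :=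
  Tendsto (fun N => ∑ k ∈ Finset.range N, c k • φ k) atTop (𝓝 x)

/-- `{(φₖ, pₖ)}` is a pseudo-basis of `H`, with `{φₖ}` a sequence of nonzero vectors dense in the
closed unit ball, and whose coefficient functions form a homeomorphism `x ↦ (pₖ(x))ₖ` of `H` onto
a subset `L` of `ℓ¹` such that `(pₖ(x))ₖ` is the only element of `L` representing `x`. -/
structure IsPseudoBasis {H : Type*} [NormedAddCommGroup H] [NormedSpace ℝ H]
    (φ : ℕ → H) (p : ℕ → H → ℝ) : Prop where
  ne_zero : ∀ k, φ k ≠ 0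
  norm_le_one : ∀ k, ‖φ k‖ ≤ 1
  dense : Metric.closedBall (0 : H) 1 ⊆ closure (Set.range φ)
  homeo : ∃ (L : Set (lp (fun _ : ℕ => ℝ) 1)) (e : H ≃ₜ L), ∀ x : H,
    (∀ k, (e x).1 k = p k x) ∧ SeriesConvergesTo φ (fun k => p k x) x ∧
      ∀ c ∈ L, SeriesConvergesTo φ (fun k => c k) x → c = (e x).1

/-! Large deviations and exponential tightness compete. By the lower bound, an open neighbourhood of
a path with finite rate `I` has probability at least about `exp (-n I)`. Exponential tightness at
level `I + 1` gives one constant `K` such that, for each choice of unit-bounded simple integrands,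
the integral exceeds `K` with probability at most about `exp (-n (I + 1))`. So every neighbourhood
of `(x, y)` contains a sample path whose integral is at most `K`. For a deterministic step integrand
the integral is a finite sum of increments of the `Y n (φ j)`; shrinking the neighbourhood transfers
the bound to `y`, with the same `K`. This is `exists_abs_sum_increments_le`.

That single inequality gives the rest. With one time step from `0` to `t` (where `y j 0 = 0`), it
says that `φ j ↦ y j t` defines a functional of norm at most `K` on the span of the `φ j`, which is
dense; `ystar t` is its extension. With many steps and, on each, a `φ k` that nearly norms the
increment of `ystar`, it bounds the total variation by `K`. Uniform convergence holds because the
partial sums are `ystar t` applied to partial sums of `∑ p j h • φ j`, whose `ℓ¹` coefficient tails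
are uniformly small on compact sets. -/

/-! ### Neighbourhoods and evaluation in the Skorokhod topology. -/

section Skorokhod

variable {E : Type*} [UniformSpace E]

lemma mem_skorokhodNhd_self (x : CadlagPath E) (T : ℝ≥0) {ε : ℝ} (hε : 0 < ε) {V : Set (E × E)}
    (hV : V ∈ 𝓤 E) : x ∈ skorokhodNhd x T ε V :=
  ⟨OrderIso.refl _, fun t _ => ⟨by simpa using hε, refl_mem_uniformity hV⟩⟩

/-- Time changes compose. The first one may push `t ≤ T` beyond `T` by up to `ε / 2`, hence the
longer horizon for the second. -/
lemma skorokhodNhd_subset_of_mem {x y : CadlagPath E} {T : ℝ≥0} {ε : ℝ}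
    {V W : Set (E × E)} (hVW : ∀ a b c, (a, b) ∈ W → (b, c) ∈ W → (a, c) ∈ V)
    (hy : y ∈ skorokhodNhd x T (ε / 2) W) :
    skorokhodNhd y (T + (ε / 2).toNNReal) (ε / 2) W ⊆ skorokhodNhd x T ε V := by
  rintro z ⟨θ', hz⟩
  obtain ⟨θ, hy⟩ := hy
  refine ⟨θ.trans θ', fun t ht => ?_⟩
  have h1 := hy t ht
  have hle : θ t ≤ T + (ε / 2).toNNReal := by
    rw [← NNReal.coe_le_coe, NNReal.coe_add]
    have := (abs_lt.1 h1.1).2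
    have := Real.le_coe_toNNReal (ε / 2)
    have : (t : ℝ) ≤ T := ht
    linarith
  have h2 := hz _ hle
  refine ⟨?_, hVW _ _ _ h1.2 h2.2⟩
  rw [OrderIso.trans_apply]
  calc |(θ' (θ t) : ℝ) - t| = |((θ' (θ t) : ℝ) - θ t) + (θ t - t)| := by ring_nf
    _ ≤ |(θ' (θ t) : ℝ) - θ t| + |(θ t : ℝ) - t| := abs_add_le _ _
    _ < ε := by linarith [h1.1, h2.1]

/-- The topology is given by its open sets, so it must be checked that basic neighbourhoods have
interior: the paths with some basic neighbourhood inside form an open set, by the triangle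
inequality above. -/
lemma exists_isOpen_subset_skorokhodNhd (x : CadlagPath E) (T : ℝ≥0) {ε : ℝ} (hε : 0 < ε)
    {V : Set (E × E)} (hV : V ∈ 𝓤 E) :
    ∃ U : Set (CadlagPath E), IsOpen U ∧ x ∈ U ∧ U ⊆ skorokhodNhd x T ε V := by
  refine ⟨{y | ∃ (T' : ℝ≥0) (ε' : ℝ), 0 < ε' ∧ ∃ W ∈ 𝓤 E,
    skorokhodNhd y T' ε' W ⊆ skorokhodNhd x T ε V}, ?_, ⟨T, ε, hε, V, hV, subset_rfl⟩, ?_⟩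
  · rintro y ⟨T', ε', hε', W, hW, hsub⟩
    obtain ⟨W', hW', hcomp⟩ := comp_mem_uniformity_sets hW
    refine ⟨T', ε' / 2, half_pos hε', W', hW', fun z hz => ?_⟩
    exact ⟨_, _, half_pos hε', W', hW',
      (skorokhodNhd_subset_of_mem (fun a b c h h' => hcomp ⟨b, h, h'⟩) hz).trans hsub⟩
  · rintro y ⟨T', ε', hε', W, hW, hsub⟩
    exact hsub (mem_skorokhodNhd_self y T' hε' hW)

/-- Time changes fix `0`, so evaluation there is continuous even though evaluation at a jump is not.
-/
lemma exists_isOpen_apply_zero_mem (x : CadlagPath E) {V : Set (E × E)} (hV : V ∈ 𝓤 E) :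
    ∃ U : Set (CadlagPath E), IsOpen U ∧ x ∈ U ∧ ∀ z ∈ U, (x.1 0, z.1 0) ∈ V := by
  obtain ⟨U, hU, hxU, hsub⟩ := exists_isOpen_subset_skorokhodNhd x 0 one_pos hV
  refine ⟨U, hU, hxU, fun z hz => ?_⟩
  obtain ⟨θ, hθ⟩ := hsub hz
  have h0 : θ 0 = 0 := by simpa using θ.map_bot
  simpa [h0] using (hθ 0 le_rfl).2

/-- Evaluating a nearby path slightly after `t` gives a value close to `x t`, because of the
right continuity of `x`; this holds also at the discontinuities of `x`. -/
lemma exists_isOpen_delayed_eval_mem (x : CadlagPath E) (S : Finset ℝ≥0) {V : Set (E × E)}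
    (hV : V ∈ 𝓤 E) :
    ∃ δ : ℝ≥0, δ ≤ 1 ∧ ∃ U : Set (CadlagPath E), IsOpen U ∧ x ∈ U ∧
      ∀ z ∈ U, ∀ t ∈ S, (x.1 t, z.1 (t + δ)) ∈ V := by
  obtain ⟨W, hW, hcomp⟩ := comp_mem_uniformity_sets hV
  have hev : ∀ᶠ r : ℝ≥0 in 𝓝[>] 0, ∀ t ∈ S, ∀ s ∈ Set.Ico t (t + r), (x.1 t, x.1 s) ∈ W := by
    rw [Filter.eventually_all_finset]
    intro t _
    have h1 : ∀ᶠ s in 𝓝[≥] t, (x.1 t, x.1 s) ∈ W :=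
      (x.2 t).1 (UniformSpace.ball_mem_nhds _ hW)
    obtain ⟨u, htu, hu⟩ := (mem_nhdsGE_iff_exists_Ico_subset' (lt_add_one t)).1 h1
    have hpos : 0 < u - t := tsub_pos_of_lt htu
    filter_upwards [Ioo_mem_nhdsGT hpos] with r hr s hs
    refine hu ⟨hs.1, hs.2.trans_le ?_⟩
    calc t + r ≤ t + (u - t) := by gcongr; exact hr.2.le
      _ = u := add_tsub_cancel_of_le (le_of_lt htu)
  obtain ⟨r, hr, hr0, hr1⟩ := (hev.and (Ioo_mem_nhdsGT (zero_lt_one' ℝ≥0))).exists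
  -- Delay and time tolerance are both `r / 2`, so the preimage of `t + r / 2` under the time change
  -- lies strictly between `t` and `t + r`, where `x` is close to `x t`.
  have hδ : 0 < r / 2 := half_pos hr0
  obtain ⟨U, hU, hxU, hsub⟩ := exists_isOpen_subset_skorokhodNhd x (S.sup id + r)
    (ε := (r / 2 : ℝ≥0)) (NNReal.coe_pos.2 hδ) hW
  refine ⟨r / 2, (half_le_self hr0.le).trans hr1.le, U, hU, hxU, fun z hz t ht => ?_⟩
  obtain ⟨θ, hθ⟩ := hsub hz
  have htS : t ≤ S.sup id := Finset.le_sup (f := id) ht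
  have hts : t < θ.symm (t + r / 2) := by
    rw [← θ.lt_iff_lt, θ.apply_symm_apply, ← NNReal.coe_lt_coe]
    have := (abs_lt.1 (hθ t (htS.trans le_self_add)).1).2
    push_cast at this ⊢
    linarith
  have hst : θ.symm (t + r / 2) < t + r := by
    rw [← θ.lt_iff_lt, θ.apply_symm_apply, ← NNReal.coe_lt_coe]
    have := (abs_lt.1 (hθ (t + r) (by gcongr)).1).1
    push_cast at this ⊢
    linarith
  have h2 := (hθ _ (hst.le.trans (by gcongr : t + r ≤ S.sup id + r))).2
  rw [θ.apply_symm_apply] at h2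
  exact hcomp ⟨_, hr t ht _ ⟨hts.le, hst⟩, h2⟩

end Skorokhod

/-! ### Comparison of exponential rates. -/

/-- Events whose exponential rate is faster than the rate of a point do not contain the events
that the process is near this point. -/
lemma SatisfiesLDP.exists_mem_notMem {D : Type*} [TopologicalSpace D] {Ω : ℕ → Type*}
    [∀ n, MeasurableSpace (Ω n)] {P : ∀ n, Measure (Ω n)} {W : ∀ n, Ω n → D}
    {I : D → ℝ≥0∞} (hI : SatisfiesLDP P W I) {w : D} {O : Set D} (hO : IsOpen O) (hw : w ∈ O)
    {a : EReal} (ha : (I w : EReal) < a) {A : ∀ n, Set (Ω n)}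
    (hA : limsup (fun n : ℕ => (((n : ℝ)⁻¹ : ℝ) : EReal) * ENNReal.log (P n (A n))) atTop ≤ -a) :
    ∃ n ω, W n ω ∈ O ∧ ω ∉ A n := by
  by_contra! hcon
  have h1 : -a < -(I w : EReal) := EReal.neg_lt_neg_iff.2 ha
  have h2 : -(I w : EReal) ≤ -(⨅ w ∈ O, (I w : EReal)) :=
    EReal.neg_le_neg_iff.2 (iInf₂_le w hw)
  have h3 : ∀ n : ℕ, (((n : ℝ)⁻¹ : ℝ) : EReal) * ENNReal.log (P n {ω | W n ω ∈ O}) ≤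
      (((n : ℝ)⁻¹ : ℝ) : EReal) * ENNReal.log (P n (A n)) := fun n =>
    mul_le_mul_of_nonneg_left (ENNReal.log_monotone (measure_mono (hcon n)))
      (EReal.coe_nonneg.2 (by positivity))
  have h4 := (h2.trans (hI.lower O hO)).trans
    ((liminf_le_liminf (Eventually.of_forall h3)).trans liminf_le_limsup)
  exact absurd (h4.trans hA) (not_le.2 h1)

/-! ### Stochastic integrals of deterministic step functions. -/

section StochasticIntegral

lemma IsTimePartition.hasFiniteSupport {π : ℕ → ℝ≥0} {δ : ℝ≥0} (hπ : IsTimePartition π δ)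
    {Ω : Type*} (ξ V : ℝ≥0 → Ω → ℝ) (t : ℝ≥0) (ω : Ω) :
    ∃ M, ∀ i, M ≤ i → ξ (π i) ω * (V (min (π (i + 1)) t) ω - V (min (π i) t) ω) = 0 := by
  obtain ⟨M, hM⟩ := eventually_atTop.1 (hπ.tendsto.eventually_ge_atTop t)
  refine ⟨M, fun i hi => ?_⟩
  rw [min_eq_right (hM i hi), min_eq_right (hM (i + 1) (by omega)), sub_self, mul_zero]

lemma IsTimePartition.summable {π : ℕ → ℝ≥0} {δ : ℝ≥0} (hπ : IsTimePartition π δ)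
    {Ω : Type*} (ξ V : ℝ≥0 → Ω → ℝ) (t : ℝ≥0) (ω : Ω) :
    Summable fun i => ξ (π i) ω * (V (min (π (i + 1)) t) ω - V (min (π i) t) ω) := by
  obtain ⟨M, hM⟩ := hπ.hasFiniteSupport ξ V t ω
  refine summable_of_ne_finset_zero (s := Finset.range M) fun i hi => hM i ?_
  simpa using hi

lemma runningSup_add_le {Ω : Type*} (J₁ J₂ : ℝ≥0 → Ω → ℝ) (T : ℝ≥0) (ω : Ω) :
    runningSup (J₁ + J₂) T ω ≤ runningSup J₁ T ω + runningSup J₂ T ω :=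
  iSup₂_le fun s hs => (enorm_add_le _ _).trans
    (add_le_add (le_iSup₂ (f := fun s (_ : s ≤ T) => ‖J₁ s ω‖ₑ) s hs)
      (le_iSup₂ (f := fun s (_ : s ≤ T) => ‖J₂ s ω‖ₑ) s hs))

lemma runningSup_const_mul_le {Ω : Type*} (c : ℝ) (J : ℝ≥0 → Ω → ℝ) (T : ℝ≥0) (ω : Ω) :
    runningSup (fun s ω => c * J s ω) T ω ≤ ‖c‖ₑ * runningSup J T ω :=
  iSup₂_le fun s hs => by
    rw [enorm_mul]
    gcongr
    exact le_iSup₂ (f := fun s (_ : s ≤ T) => ‖J s ω‖ₑ) s hs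

variable {Ω : Type*} {mΩ : MeasurableSpace Ω} {P : Measure Ω} {V : ℝ≥0 → Ω → ℝ}

lemma IsStochIntegral.add {ξ₁ ξ₂ J₁ J₂ : ℝ≥0 → Ω → ℝ}
    (h₁ : IsStochIntegral P ξ₁ V J₁) (h₂ : IsStochIntegral P ξ₂ V J₂) :
    IsStochIntegral P (fun t ω => ξ₁ t ω + ξ₂ t ω) V (fun t ω => J₁ t ω + J₂ t ω) := by
  intro T η ε hη hε
  obtain ⟨δ₁, hδ₁, H₁⟩ := h₁ T (η / 2) (ε / 2) (ENNReal.half_pos hη.ne') (ENNReal.half_pos hε.ne')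
  obtain ⟨δ₂, hδ₂, H₂⟩ := h₂ T (η / 2) (ε / 2) (ENNReal.half_pos hη.ne') (ENNReal.half_pos hε.ne')
  refine ⟨min δ₁ δ₂, lt_min hδ₁ hδ₂, fun π hπ => ?_⟩
  have hπ₁ : IsTimePartition π δ₁ := ⟨hπ.zero, hπ.mono, hπ.tendsto, fun i =>
    (hπ.mesh i).trans (by gcongr; exact min_le_left _ _)⟩
  have hπ₂ : IsTimePartition π δ₂ := ⟨hπ.zero, hπ.mono, hπ.tendsto, fun i =>
    (hπ.mesh i).trans (by gcongr; exact min_le_right _ _)⟩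
  have key : (fun s ω => riemannSum π (fun t ω => ξ₁ t ω + ξ₂ t ω) V s ω - (J₁ s ω + J₂ s ω)) =
      (fun s ω => riemannSum π ξ₁ V s ω - J₁ s ω) +
        (fun s ω => riemannSum π ξ₂ V s ω - J₂ s ω) := by
    ext s ω
    have : riemannSum π (fun t ω => ξ₁ t ω + ξ₂ t ω) V s ω =
        riemannSum π ξ₁ V s ω + riemannSum π ξ₂ V s ω := by
      simp only [riemannSum, add_mul]
      exact (hπ.summable ξ₁ V s ω).tsum_add (hπ.summable ξ₂ V s ω)
    simp only [Pi.add_apply, this]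
    ring
  rw [key]
  refine le_trans (measure_mono ?_) ((measure_union_le _ _).trans
    ((add_le_add (H₁ π hπ₁) (H₂ π hπ₂)).trans (ENNReal.add_halves ε).le))
  intro ω hω
  by_contra hcon
  simp only [Set.mem_union, Set.mem_ofPred_eq, not_or, not_lt] at hcon hω
  exact absurd (hω.trans_le ((runningSup_add_le _ _ T ω).trans (add_le_add hcon.1 hcon.2)))
    (by rw [ENNReal.add_halves]; exact lt_irrefl _)

lemma IsStochIntegral.const_mul {ξ J : ℝ≥0 → Ω → ℝ} (h : IsStochIntegral P ξ V J) (c : ℝ) :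
    IsStochIntegral P (fun t ω => c * ξ t ω) V (fun t ω => c * J t ω) := by
  intro T η ε hη hε
  -- For `c = 0` the quotient is `∞`, so no case distinction is needed.
  obtain ⟨δ, hδ, H⟩ := h T (η / ‖c‖ₑ) ε (ENNReal.div_pos hη.ne' enorm_ne_top) hε
  refine ⟨δ, hδ, fun π hπ => (measure_mono fun ω hω => ?_).trans (H π hπ)⟩
  have key : (fun s ω => riemannSum π (fun t ω => c * ξ t ω) V s ω - c * J s ω) =
      fun s ω => c * (riemannSum π ξ V s ω - J s ω) := by
    ext s ω
    simp only [riemannSum, mul_assoc, tsum_mul_left]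
    ring
  rw [Set.mem_ofPred_eq, key] at hω
  exact ENNReal.div_lt_of_lt_mul' (hω.trans_le (runningSup_const_mul_le c _ T ω))

lemma IsStochIntegral.zero : IsStochIntegral P (fun _ _ => 0) V (fun _ _ => 0) := by
  intro T η ε hη hε
  refine ⟨1, one_pos, fun π _ => ?_⟩
  simp [riemannSum, runningSup]

lemma IsStochIntegral.sum {ι : Type*} (s : Finset ι) {ξ J : ι → ℝ≥0 → Ω → ℝ}
    (h : ∀ i ∈ s, IsStochIntegral P (ξ i) V (J i)) :
    IsStochIntegral P (fun t ω => ∑ i ∈ s, ξ i t ω) V (fun t ω => ∑ i ∈ s, J i t ω) := by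
  classical
  induction s using Finset.induction_on with
  | empty => simpa using IsStochIntegral.zero
  | insert i s hi ih =>
    simp only [Finset.sum_insert hi]
    exact (h i (Finset.mem_insert_self i s)).add
      (ih fun j hj => h j (Finset.mem_insert_of_mem hj))

/-- The sum telescopes from the first partition point `b` that is at least `a`; it overshoots `a` by
at most the mesh. -/
lemma riemannSum_indicator_Ici {π : ℕ → ℝ≥0} {δ : ℝ≥0} (hπ : IsTimePartition π δ) (a : ℝ≥0) :
    ∃ b, a ≤ b ∧ b ≤ a + δ ∧ ∀ t ω,
      riemannSum π (fun t _ => (Set.Ici a).indicator 1 t) V t ω = V t ω - V (min b t) ω := by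
  classical
  have hex : ∃ k, a ≤ π k := (hπ.tendsto.eventually_ge_atTop a).exists
  refine ⟨π (Nat.find hex), Nat.find_spec hex, ?_, fun t ω => ?_⟩
  · rcases hk : Nat.find hex with _ | k
    · rw [hπ.zero]; exact zero_le
    · have : π k < a := not_le.1 (Nat.find_min hex (by omega))
      exact (hπ.mesh k).trans (by gcongr)
  · set k := Nat.find hex with hk
    have hiff : ∀ i, a ≤ π i ↔ k ≤ i := fun i =>
      ⟨fun h => Nat.find_min' hex h, fun h => (Nat.find_spec hex).trans (hπ.mono h)⟩
    obtain ⟨M, hM⟩ := eventually_atTop.1 (hπ.tendsto.eventually_ge_atTop t)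
    have hMt := hM (max M k) (le_max_left _ _)
    have hts : riemannSum π (fun t _ => (Set.Ici a).indicator 1 t) V t ω =
        ∑ i ∈ Finset.Ico k (max M k), (V (min (π (i + 1)) t) ω - V (min (π i) t) ω) := by
      rw [riemannSum, tsum_eq_sum (s := Finset.Ico k (max M k))]
      · refine Finset.sum_congr rfl fun i hi => ?_
        rw [Set.indicator_of_mem (Set.mem_Ici.2 ((hiff i).2 (Finset.mem_Ico.1 hi).1)),
          Pi.one_apply, one_mul]
      · intro i hi
        rcases lt_or_ge i k with h | h
        · rw [Set.indicator_of_notMem (by simpa [hiff] using h), zero_mul]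
        · have hMi : M ≤ i := by
            simp only [Finset.mem_Ico, not_and, not_lt, max_le_iff] at hi
            exact (hi h).1
          rw [min_eq_right (hM i hMi), min_eq_right (hM (i + 1) (by omega)), sub_self, mul_zero]
    rw [hts, Finset.sum_Ico_sub (fun i => V (min (π i) t) ω) (le_max_right _ _),
      min_eq_right hMt]

/-- The oscillation to the right of a fixed time tends to zero in probability. -/
lemma exists_measure_oscillation_le [IsFiniteMeasure P] (hV : ∀ t, Measurable (V t))
    (hcad : ∀ ω, IsCadlag fun t => V t ω) (a : ℝ≥0) {η ε : ℝ≥0∞} (hη : 0 < η) (hε : 0 < ε) :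
    ∃ δ : ℝ≥0, 0 < δ ∧
      P {ω | ∃ s ∈ Set.Icc a (a + δ), η < ‖V a ω - V s ω‖ₑ} ≤ ε := by
  obtain ⟨D, hDc, hDd⟩ := TopologicalSpace.exists_countable_dense ℝ≥0
  let r : ℕ → ℝ≥0 := fun n => 1 / ((n : ℝ≥0) + 1)
  have hr : ∀ n, 0 < r n := fun n => by positivity
  have hra : Antitone r := fun m n h => by simp only [r]; gcongr
  have hr0 : Tendsto r atTop (𝓝 0) := tendsto_one_div_add_atTop_nhds_zero_nat
  -- A countable dense set of times makes these events measurable. They decrease to `∅` by right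
  -- continuity at `a`, and right continuity at `s` moves any large oscillation to a time in `D`.
  let B : ℕ → Set Ω := fun n => ⋃ d ∈ D ∩ Set.Ico a (a + r n), {ω | η < ‖V a ω - V d ω‖ₑ}
  have hB : ∀ n, MeasurableSet (B n) := fun n =>
    MeasurableSet.biUnion (hDc.mono Set.inter_subset_left) fun d _ =>
      measurableSet_lt measurable_const ((hV a).sub (hV d)).enorm
  have hBa : Antitone B := fun m n h =>
    Set.biUnion_mono (Set.inter_subset_inter_right _ (Set.Ico_subset_Ico_right (by
      gcongr; exact hra h))) fun _ _ => subset_rfl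
  have hcont : ∀ ω t, ContinuousWithinAt (fun s => ‖V a ω - V s ω‖ₑ) (Set.Ici t) t := fun ω t =>
    (continuous_enorm.continuousAt.comp_continuousWithinAt
      (continuousWithinAt_const.sub (hcad ω t).1))
  have hBe : ⋂ n, B n = ∅ := by
    rw [Set.eq_empty_iff_forall_notMem]
    intro ω hω
    have h1 : ∀ᶠ s in 𝓝[≥] a, ‖V a ω - V s ω‖ₑ < η :=
      (hcont ω a).eventually_lt_const (by simpa using hη)
    obtain ⟨u, hau, hu⟩ := (mem_nhdsGE_iff_exists_Ico_subset' (lt_add_one a)).1 h1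
    have h2 : ∀ᶠ n in atTop, r n < u - a := hr0.eventually_lt_const (tsub_pos_of_lt hau)
    obtain ⟨n, hn⟩ := h2.exists
    have h3 := Set.mem_iInter.1 hω n
    simp only [B, Set.mem_iUnion, Set.mem_ofPred_eq, exists_prop] at h3
    obtain ⟨d, ⟨-, hd⟩, hlt⟩ := h3
    refine lt_asymm hlt (hu ⟨hd.1, hd.2.trans_le ?_⟩)
    calc a + r n ≤ a + (u - a) := by gcongr
      _ = u := add_tsub_cancel_of_le (le_of_lt hau)
  have hlim := tendsto_measure_iInter_atTop (μ := P) (fun n => (hB n).nullMeasurableSet) hBa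
    ⟨0, measure_ne_top _ _⟩
  rw [hBe, measure_empty] at hlim
  obtain ⟨n, hn⟩ := (hlim.eventually_le_const hε).exists
  refine ⟨r n / 2, half_pos (hr n), (measure_mono fun ω hω => ?_).trans hn⟩
  obtain ⟨s, hs, hlt⟩ := hω
  have hsr : s < a + r n := hs.2.trans_lt (by gcongr; exact half_lt_self (hr n))
  obtain ⟨u, hsu, hu⟩ := (mem_nhdsGE_iff_exists_mem_Ioc_Ico_subset hsr).1
    ((hcont ω s).eventually_const_lt hlt)
  obtain ⟨d, hdD, hd⟩ := hDd.exists_between hsu.1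
  simp only [B, Set.mem_iUnion, Set.mem_ofPred_eq, exists_prop]
  exact ⟨d, ⟨hdD, hs.1.trans hd.1.le, hd.2.trans_le hsu.2⟩, hu ⟨hd.1.le, hd.2⟩⟩

/-- The error of the Riemann sum is an increment of `V` starting at `a` of length at most the mesh,
so it is small in probability uniformly in the upper time limit. -/
lemma IsStochIntegral.indicator_Ici [IsFiniteMeasure P] (hV : ∀ t, Measurable (V t))
    (hcad : ∀ ω, IsCadlag fun t => V t ω) (a : ℝ≥0) :
    IsStochIntegral P (fun t _ => (Set.Ici a).indicator 1 t) V
      (fun t ω => V t ω - V (min a t) ω) := by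
  intro T η ε hη hε
  obtain ⟨δ, hδ, h⟩ := exists_measure_oscillation_le (P := P) hV hcad a hη hε
  refine ⟨δ, hδ, fun π hπ => (measure_mono fun ω hω => ?_).trans h⟩
  obtain ⟨b, hab, hb, hsum⟩ := riemannSum_indicator_Ici (V := V) hπ a
  simp only [runningSup, Set.mem_ofPred_eq, lt_iSup_iff, exists_prop] at hω
  obtain ⟨s, -, hs⟩ := hω
  rw [hsum, show V s ω - V (min b s) ω - (V s ω - V (min a s) ω) =
    V (min a s) ω - V (min b s) ω by ring] at hs
  rcases le_total s a with hsa | has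
  · rw [min_eq_right hsa, min_eq_right (hsa.trans hab)] at hs
    simp at hs
  · rw [min_eq_left has] at hs
    exact ⟨min b s, ⟨le_min hab has, (min_le_left _ _).trans hb⟩, hs⟩

lemma IsStochIntegral.indicator_Ico [IsFiniteMeasure P] (hV : ∀ t, Measurable (V t))
    (hcad : ∀ ω, IsCadlag fun t => V t ω) {a b : ℝ≥0} (hab : a ≤ b) :
    IsStochIntegral P (fun t _ => (Set.Ico a b).indicator 1 t) V
      (fun t ω => V (min b t) ω - V (min a t) ω) := by
  have h := (IsStochIntegral.indicator_Ici (P := P) hV hcad a).add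
    ((IsStochIntegral.indicator_Ici (P := P) hV hcad b).const_mul (-1))
  convert h using 3 with t ω t ω
  · simp only [Set.indicator_apply, Set.mem_Ico, Set.mem_Ici, Pi.one_apply]
    split_ifs <;> grind
  · ring

end StochasticIntegral

/-! ### Deterministic step processes and their integrals. -/

lemma isCadlag_indicator_Ico (a b : ℝ≥0) :
    IsCadlag ((Set.Ico a b).indicator (1 : ℝ≥0 → ℝ)) := by
  have hmem : ∀ t, ∀ᶠ s in 𝓝[≥] t, (s ∈ Set.Ico a b ↔ t ∈ Set.Ico a b) := by
    intro t
    rcases lt_or_ge t a with h | h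
    · filter_upwards [mem_nhdsWithin_of_mem_nhds (Iio_mem_nhds h)] with s hs
      simp [not_le.2 h, not_le.2 (Set.mem_Iio.1 hs)]
    · rcases lt_or_ge t b with h' | h'
      · filter_upwards [mem_nhdsWithin_of_mem_nhds (Iio_mem_nhds h'), self_mem_nhdsWithin]
          with s hs hs'
        simp [h, h', Set.mem_Iio.1 hs, h.trans hs']
      · filter_upwards [self_mem_nhdsWithin] with s hs
        simp [not_lt.2 h', not_lt.2 (h'.trans hs)]
  have hleft : ∀ t, ∀ᶠ s in 𝓝[<] t, (s ∈ Set.Ico a b ↔ a < t ∧ t ≤ b) := by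
    intro t
    rcases le_or_gt t a with h | h
    · filter_upwards [self_mem_nhdsWithin] with s hs
      simp [not_lt.2 h, (lt_of_lt_of_le hs h)]
    · rcases le_or_gt t b with h' | h'
      · filter_upwards [mem_nhdsWithin_of_mem_nhds (Ioi_mem_nhds h), self_mem_nhdsWithin]
          with s hs hs'
        simp [h, h', (Set.mem_Ioi.1 hs).le, lt_of_lt_of_le hs' h']
      · filter_upwards [mem_nhdsWithin_of_mem_nhds (Ioi_mem_nhds h')] with s hs
        simp [not_le.2 h', (Set.mem_Ioi.1 hs).le]
  classical
  intro t
  refine ⟨tendsto_nhds_of_eventually_eq ?_, if a < t ∧ t ≤ b then 1 else 0,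
    tendsto_nhds_of_eventually_eq ?_⟩
  · filter_upwards [hmem t] with s hs
    simp only [Set.indicator_apply, hs, Pi.one_apply]
  · filter_upwards [hleft t] with s hs
    simp only [Set.indicator_apply, hs, Pi.one_apply]

lemma IsCadlag.const_mul {f : ℝ≥0 → ℝ} (hf : IsCadlag f) (c : ℝ) :
    IsCadlag fun t => c * f t := fun t =>
  ⟨(hf t).1.const_mul c, _, (hf t).2.choose_spec.const_mul c⟩

lemma IsCadlag.sum {ι : Type*} (s : Finset ι) {f : ι → ℝ≥0 → ℝ} (hf : ∀ i ∈ s, IsCadlag (f i)) :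
    IsCadlag fun t => ∑ i ∈ s, f i t := fun t => by
  choose l hl using fun i (hi : i ∈ s) => (hf i hi t).2
  refine ⟨tendsto_finsetSum _ fun i hi => (hf i hi t).1,
    ∑ i ∈ s.attach, l i.1 i.2, ?_⟩
  simp_rw [← Finset.sum_attach s]
  exact tendsto_finsetSum _ fun i _ => hl i.1 i.2

section StepProcess

variable {Ω : Type*} {mΩ : MeasurableSpace Ω} {H : Type*} [NormedAddCommGroup H] [NormedSpace ℝ H]

/-- The deterministic step process equal to `∑ⱼ c i j • φ j` on `[u i, u (i + 1))`, `i < m`. -/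
noncomputable def stepProcess (F : Filtration ℝ≥0 mΩ) (φ : ℕ → H) (u : ℕ → ℝ≥0) (c : ℕ → ℕ → ℝ) (m N : ℕ) :
    SimpleProcess F H where
  m := N
  ξ k t _ := ∑ i ∈ Finset.range m, c i k * (Set.Ico (u i) (u (i + 1))).indicator 1 t
  h k := φ k
  adapted _ _ := stronglyMeasurable_const
  cadlag _ _ := IsCadlag.sum _ fun _ _ => (isCadlag_indicator_Ico _ _).const_mul _

/-- The intervals are disjoint, so at each time the process equals one of the step vectors or `0`.
-/
lemma stepProcess_unitBoundedUpTo (F : Filtration ℝ≥0 mΩ) {φ : ℕ → H} {u : ℕ → ℝ≥0}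
    (hu : Monotone u) {c : ℕ → ℕ → ℝ} {m N : ℕ}
    (hc : ∀ i < m, ‖∑ j ∈ Finset.range N, c i j • φ j‖ ≤ 1) (T : ℝ≥0) :
    (stepProcess F φ u c m N).UnitBoundedUpTo T := by
  intro ω s _
  have heval : (stepProcess F φ u c m N).eval s ω = ∑ i ∈ Finset.range m,
      (Set.Ico (u i) (u (i + 1))).indicator (1 : ℝ≥0 → ℝ) s •
        ∑ j ∈ Finset.range N, c i j • φ j := by
    refine (Fin.sum_univ_eq_sum_range (fun j => (∑ i ∈ Finset.range m,
      c i j * (Set.Ico (u i) (u (i + 1))).indicator (1 : ℝ≥0 → ℝ) s) • φ j) N).trans ?_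
    simp only [Finset.sum_smul, Finset.smul_sum]
    rw [Finset.sum_comm]
    simp only [smul_smul, mul_comm]
  rw [heval]
  by_cases hs : ∃ i < m, s ∈ Set.Ico (u i) (u (i + 1))
  · obtain ⟨i, him, hi⟩ := hs
    rw [Finset.sum_eq_single_of_mem i (Finset.mem_range.2 him), Set.indicator_of_mem hi]
    · simpa using hc i him
    · intro k _ hki
      rw [Set.indicator_of_notMem, zero_smul]
      intro hk
      exact Set.disjoint_left.1 (hu.pairwise_disjoint_on_Ico_succ hki) hk hi
  · push Not at hs
    rw [Finset.sum_eq_zero fun i hi => by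
      rw [Set.indicator_of_notMem (hs i (Finset.mem_range.1 hi)), zero_smul]]
    simp

lemma stepProcess_isIntegral {P : Measure Ω} [IsFiniteMeasure P] {F : Filtration ℝ≥0 mΩ}
    {Y : H → ℝ≥0 → Ω → ℝ} (hY : IsHSharpSemimartingale P F Y) (φ : ℕ → H) {u : ℕ → ℝ≥0}
    (hu : Monotone u) (c : ℕ → ℕ → ℝ) (m N : ℕ) :
    (stepProcess F φ u c m N).IsIntegral P Y fun t ω => ∑ j ∈ Finset.range N,
      ∑ i ∈ Finset.range m, c i j * (Y (φ j) (min (u (i + 1)) t) ω - Y (φ j) (min (u i) t) ω) := by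
  refine ⟨fun j t ω => ∑ i ∈ Finset.range m,
      c i j * (Y (φ j) (min (u (i + 1)) t) ω - Y (φ j) (min (u i) t) ω), fun j => ?_, fun t ω =>
    (Fin.sum_univ_eq_sum_range (fun j => ∑ i ∈ Finset.range m,
      c i j * (Y (φ j) (min (u (i + 1)) t) ω - Y (φ j) (min (u i) t) ω)) N).symm⟩
  exact IsStochIntegral.sum (P := P) (V := Y (φ j)) (Finset.range m)
    (ξ := fun i t _ => c i j * (Set.Ico (u i) (u (i + 1))).indicator 1 t)
    (J := fun i t ω => c i j * (Y (φ j) (min (u (i + 1)) t) ω - Y (φ j) (min (u i) t) ω))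
    fun i _ => (IsStochIntegral.indicator_Ico
      (fun t => (((hY.semimartingale (φ j)).1 t).mono (F.le t)).measurable)
      (hY.cadlag _) (hu i.le_succ)).const_mul _

end StepProcess

/-! ### The bound on weighted increments of a path of finite rate. -/

lemma coords_close_mem_uniformity {E : Type*} [UniformSpace E] (N : ℕ) {η : ℝ} (hη : 0 < η) :
    {q : (E × (ℕ → ℝ)) × (E × (ℕ → ℝ)) | ∀ j ∈ Finset.range N, |q.1.2 j - q.2.2 j| < η} ∈
      𝓤 (E × (ℕ → ℝ)) := by
  have : ∀ᶠ q in 𝓤 (E × (ℕ → ℝ)), ∀ j ∈ Finset.range N, |q.1.2 j - q.2.2 j| < η := by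
    rw [Filter.eventually_all_finset]
    intro j _
    exact ((Pi.uniformContinuous_proj (fun _ : ℕ => ℝ) j).comp uniformContinuous_snd)
      (Metric.dist_mem_uniformity hη)
  exact this

section Bound

variable {H : Type*} [NormedAddCommGroup H] [NormedSpace ℝ H]
  {Ω : ℕ → Type*} [mΩ : ∀ n, MeasurableSpace (Ω n)]
  {P : ∀ n, Measure (Ω n)}
  {F : ∀ n, Filtration ℝ≥0 (mΩ n)}
  {X : ∀ n, ℝ≥0 → Ω n → H} {hX : ∀ n ω, IsCadlag fun t => X n t ω}
  {Y : ∀ n, H → ℝ≥0 → Ω n → ℝ} (hY : IsUniformlyExponentiallyTight P F Y)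
  {φ : ℕ → H} {I : CadlagPath (H × (ℕ → ℝ)) → ℝ≥0∞}
  (hI : SatisfiesLDP P
      (fun n ω => jointPath (fun t => X n t ω) (hX n ω) (fun j t => Y n (φ j) t ω)
        (fun j => (hY.standard n).cadlag (φ j) ω)) I)
  {x : ℝ≥0 → H} {hx : IsCadlag x} {y : ℕ → ℝ≥0 → ℝ} {hy : ∀ j, IsCadlag (y j)}
  (hxy : I (jointPath x hx y hy) < ∞)

include hI hxy in
-- Otherwise a neighbourhood of the path would force `Y n (φ j) 0 ≠ 0`, an event of probability
-- zero, and the rate would be infinite.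
lemma eq_zero_of_rate_lt_top (j : ℕ) : y j 0 = 0 := by
  by_contra hne
  obtain ⟨U, hU, hmem, hz⟩ := exists_isOpen_apply_zero_mem (jointPath x hx y hy)
    (coords_close_mem_uniformity (E := H) (j + 1) (abs_pos.2 hne))
  obtain ⟨n, ω, hω, hn⟩ := hI.exists_mem_notMem hU hmem (a := ⊤)
    (EReal.coe_ennreal_lt_coe_ennreal_iff.2 hxy) (A := fun n => {ω | Y n (φ j) 0 ω ≠ 0}) (by
      refine (limsup_le_of_le ?_ ?_)
      · isBoundedDefault
      -- The index `0` is excluded: there the factor is `0` and the product would be `0` instead of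
      -- `⊥`.
      · filter_upwards [eventually_gt_atTop 0] with n hn
        have h0 : P n {ω | Y n (φ j) 0 ω ≠ 0} = 0 := (hY.standard n).zero (φ j)
        rw [h0, ENNReal.log_zero, EReal.coe_mul_bot_of_pos (by positivity), EReal.neg_top])
  have h := hz _ hω j (Finset.self_mem_range_succ j)
  simp only [jointPath] at h
  simp only [Set.mem_ofPred_eq, not_not] at hn
  rw [hn, sub_zero] at h
  exact lt_irrefl _ h

variable [∀ n, IsProbabilityMeasure (P n)]

include hI hxy in
theorem exists_abs_sum_increments_le (T : ℝ≥0) :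
    ∃ K : ℝ, 0 ≤ K ∧ ∀ (m N : ℕ) (u : ℕ → ℝ≥0) (c : ℕ → ℕ → ℝ), Monotone u → (∀ i, u i ≤ T) →
      (∀ i < m, ‖∑ j ∈ Finset.range N, c i j • φ j‖ ≤ 1) →
      |∑ j ∈ Finset.range N, ∑ i ∈ Finset.range m, c i j * (y j (u (i + 1)) - y j (u i))| ≤ K := by
  set w := jointPath x hx y hy with hw
  -- `K` is fixed before the partition, the weights and the neighbourhood. The level is just above
  -- the rate, and the horizon `T + 1` leaves room for the delay `δ ≤ 1`.
  obtain ⟨K, hK⟩ := hY.tight ((I w).toReal + 1) (T + 1) (by positivity) (by positivity)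
  refine ⟨K, K.2, fun m N u c hu huT hc => le_of_forall_pos_le_add fun η hη => ?_⟩
  -- Each increment involves two values of `y j`, each approximated within `η'`, so the total error
  -- is at most `R * η' ≤ η`.
  set R : ℝ := ∑ j ∈ Finset.range N, ∑ i ∈ Finset.range m, 2 * |c i j| with hR
  have hR0 : 0 ≤ R := Finset.sum_nonneg fun j _ => Finset.sum_nonneg fun i _ => by positivity
  set η' : ℝ := η / (R + 1)
  have hη' : 0 < η' := by positivity
  obtain ⟨δ, hδ, U, hU, hwU, hclose⟩ := exists_isOpen_delayed_eval_mem w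
    ((Finset.range (m + 1)).image u) (coords_close_mem_uniformity (E := H) N hη')
  have hu' : Monotone fun i => u i + δ := fun i j h => by dsimp only; gcongr; exact hu h
  obtain ⟨n, ω, hω, hn⟩ := hI.exists_mem_notMem hU hwU (a := (((I w).toReal + 1 : ℝ) : EReal)) (by
      rw [← EReal.coe_toReal (x := (I w : EReal)) (by simpa using hxy.ne) (by simp),
        EReal.toReal_coe_ennreal]
      exact EReal.coe_lt_coe_iff.2 (lt_add_one _))
    (A := fun n => {ω | (K : ℝ≥0∞) < runningSup (fun t ω => ∑ j ∈ Finset.range N,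
      ∑ i ∈ Finset.range m, c i j * (Y n (φ j) (min (u (i + 1) + δ) t) ω -
        Y n (φ j) (min (u i + δ) t) ω)) (T + 1) ω}) (by
      rw [← EReal.coe_neg]
      refine le_trans (limsup_le_limsup (Eventually.of_forall fun n => ?_)) hK
      refine mul_le_mul_of_nonneg_left ?_ (EReal.coe_nonneg.2 (by positivity))
      exact le_iSup₂_of_le _ (stepProcess_unitBoundedUpTo (F n) hu' hc (T + 1))
        (le_iSup₂_of_le _ (stepProcess_isIntegral (hY.standard n).toIsHSharpSemimartingale φ hu'
          c m N) le_rfl))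
  -- At time `T + 1` all steps are over, so the integral is the full sum of delayed increments.
  have hmin : ∀ i, min (u i + δ) (T + 1) = u i + δ := fun i =>
    min_eq_left (add_le_add (huT i) hδ)
  have hJ : |∑ j ∈ Finset.range N, ∑ i ∈ Finset.range m,
      c i j * (Y n (φ j) (u (i + 1) + δ) ω - Y n (φ j) (u i + δ) ω)| ≤ K := by
    rw [Set.mem_ofPred_eq, not_lt] at hn
    have h := (le_iSup₂ (f := fun s (_ : s ≤ T + 1) => ‖∑ j ∈ Finset.range N,
      ∑ i ∈ Finset.range m, c i j * (Y n (φ j) (min (u (i + 1) + δ) s) ω -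
        Y n (φ j) (min (u i + δ) s) ω)‖ₑ) (T + 1) le_rfl).trans hn
    simp only [hmin] at h
    rw [enorm_le_coe] at h
    exact_mod_cast h
  have hy' : ∀ i ∈ Finset.range (m + 1), ∀ j ∈ Finset.range N,
      |y j (u i) - Y n (φ j) (u i + δ) ω| < η' := fun i hi j hj =>
    hclose _ hω (u i) (Finset.mem_image_of_mem u hi) j hj
  have hdiff : |∑ j ∈ Finset.range N, ∑ i ∈ Finset.range m, c i j * (y j (u (i + 1)) - y j (u i)) -
      ∑ j ∈ Finset.range N, ∑ i ∈ Finset.range m,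
        c i j * (Y n (φ j) (u (i + 1) + δ) ω - Y n (φ j) (u i + δ) ω)| ≤ R * η' := by
    rw [← Finset.sum_sub_distrib, hR, Finset.sum_mul]
    refine (Finset.abs_sum_le_sum_abs _ _).trans (Finset.sum_le_sum fun j hj => ?_)
    rw [← Finset.sum_sub_distrib, Finset.sum_mul]
    refine (Finset.abs_sum_le_sum_abs _ _).trans (Finset.sum_le_sum fun i hi => ?_)
    have hi := Finset.mem_range.1 hi
    have h1 := hy' i (Finset.mem_range.2 (by omega)) j hj
    have h2 := hy' (i + 1) (Finset.mem_range.2 (by omega)) j hj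
    rw [← mul_sub, abs_mul, mul_comm (2 : ℝ), mul_assoc]
    refine mul_le_mul_of_nonneg_left ?_ (abs_nonneg _)
    rw [abs_lt] at h1 h2
    rw [abs_le]
    constructor <;> linarith
  have hRη : R * η' ≤ η := by
    rw [mul_div_assoc', div_le_iff₀ (by positivity)]
    nlinarith
  linarith [abs_sub_abs_le_abs_sub (∑ j ∈ Finset.range N, ∑ i ∈ Finset.range m,
    c i j * (y j (u (i + 1)) - y j (u i))) (∑ j ∈ Finset.range N, ∑ i ∈ Finset.range m,
        c i j * (Y n (φ j) (u (i + 1) + δ) ω - Y n (φ j) (u i + δ) ω))]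

end Bound

/-! ### Consequences of the pseudo-basis property. -/

section PseudoBasis

variable {H : Type*} [NormedAddCommGroup H] [NormedSpace ℝ H] {φ : ℕ → H} {p : ℕ → H → ℝ}

lemma lp.sum_norm_le_norm_of_one (f : lp (fun _ : ℕ => ℝ) 1) (s : Finset ℕ) :
    ∑ j ∈ s, ‖f j‖ ≤ ‖f‖ := by
  simpa using lp.sum_rpow_le_norm_rpow (p := 1) (by simp) f s

lemma lp.summable_norm_of_one (f : lp (fun _ : ℕ => ℝ) 1) : Summable fun j => ‖f j‖ := by
  simpa using (lp.memℓp f).summable (by simp)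

/-- The `ℓ¹` tails of the coefficients of a pseudo-basis are uniformly small on compact sets. -/
lemma IsPseudoBasis.exists_tail_lt (hφ : IsPseudoBasis φ p) {C : Set H} (hC : IsCompact C)
    {ε : ℝ} (hε : 0 < ε) :
    ∃ M : ℕ, ∀ h ∈ C, ∀ t : Finset ℕ, (∀ j ∈ t, M ≤ j) → ∑ j ∈ t, |p j h| < ε := by
  obtain ⟨L, e, he⟩ := hφ.homeo
  refine hC.induction_on (p := fun C => ∃ M : ℕ, ∀ h ∈ C, ∀ t : Finset ℕ, (∀ j ∈ t, M ≤ j) →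
    ∑ j ∈ t, |p j h| < ε) ⟨0, by simp⟩ (fun A B hAB ⟨M, hM⟩ => ⟨M, fun h hh => hM h (hAB hh)⟩)
    ?_ fun a _ => ?_
  · rintro A B ⟨M, hM⟩ ⟨M', hM'⟩
    refine ⟨max M M', ?_⟩
    rintro h (hh | hh) t ht
    · exact hM h hh t fun j hj => (le_max_left _ _).trans (ht j hj)
    · exact hM' h hh t fun j hj => (le_max_right _ _).trans (ht j hj)
  -- Locally, the tail at `h` is at most the tail at `a` plus the `ℓ¹` distance of the coefficient
  -- sequences; each is made less than `ε / 2`.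
  · obtain ⟨s, hs⟩ := summable_iff_vanishing_norm.1 (lp.summable_norm_of_one (e a).1) (ε / 2)
      (half_pos hε)
    have hcont : ContinuousAt (fun h => (e h).1) a :=
      (continuous_subtype_val.comp e.continuous).continuousAt
    refine ⟨_, mem_nhdsWithin_of_mem_nhds (hcont (Metric.ball_mem_nhds _ (half_pos hε))),
      s.sup id + 1, fun h hh t ht => ?_⟩
    have hdisj : Disjoint t s := Finset.disjoint_left.2 fun j hjt hjs => by
      have h1 := ht j hjt
      have h2 : j ≤ s.sup id := Finset.le_sup (f := id) hjs
      omega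
    have h1 := (le_abs_self _).trans_lt (hs t hdisj)
    have h2 : ‖(e h).1 - (e a).1‖ < ε / 2 := by simpa [dist_eq_norm] using hh
    have h3 := lp.sum_norm_le_norm_of_one ((e h).1 - (e a).1) t
    have h4 : ∑ j ∈ t, |p j h| ≤ ∑ j ∈ t, (‖(e a).1 j‖ + ‖((e h).1 - (e a).1) j‖) := by
      refine Finset.sum_le_sum fun j _ => ?_
      rw [← (he h).1 j, ← Real.norm_eq_abs, lp.coeFn_sub, Pi.sub_apply]
      calc ‖(e h).1 j‖ = ‖(e a).1 j + ((e h).1 j - (e a).1 j)‖ := by rw [add_sub_cancel]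
        _ ≤ _ := norm_add_le _ _
    rw [Finset.sum_add_distrib] at h4
    linarith

lemma IsPseudoBasis.norm_sum_le (hφ : IsPseudoBasis φ p) (h : H) (t : Finset ℕ) :
    ‖∑ j ∈ t, p j h • φ j‖ ≤ ∑ j ∈ t, |p j h| :=
  (_root_.norm_sum_le _ _).trans (Finset.sum_le_sum fun j _ => by
    rw [norm_smul, Real.norm_eq_abs]
    exact mul_le_of_le_one_right (abs_nonneg _) (hφ.norm_le_one j))

lemma IsPseudoBasis.tendstoUniformlyOn (hφ : IsPseudoBasis φ p) {C : Set H} (hC : IsCompact C) :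
    TendstoUniformlyOn (fun N h => ∑ j ∈ Finset.range N, p j h • φ j) id atTop C := by
  rw [Metric.tendstoUniformlyOn_iff]
  intro ε hε
  obtain ⟨M, hM⟩ := hφ.exists_tail_lt hC (half_pos hε)
  filter_upwards [eventually_ge_atTop M] with N hN h hh
  obtain ⟨L, e, he⟩ := hφ.homeo
  have hlim : Tendsto (fun N' => dist (∑ k ∈ Finset.range N', p k h • φ k)
      (∑ j ∈ Finset.range N, p j h • φ j)) atTop
      (𝓝 (dist h (∑ j ∈ Finset.range N, p j h • φ j))) :=
    ((he h).2.1).dist tendsto_const_nhds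
  refine lt_of_le_of_lt (le_of_tendsto hlim ?_) (half_lt_self hε)
  filter_upwards [eventually_ge_atTop N] with N' hN'
  rw [dist_eq_norm, ← Finset.sum_Ico_eq_sub _ hN']
  exact ((hφ.norm_sum_le h _).trans_lt
    (hM h hh _ fun j hj => hN.trans (Finset.mem_Ico.1 hj).1)).le

/-- The closed span contains the unit ball, hence by scaling every vector. -/
lemma IsPseudoBasis.denseRange_linearCombination (hφ : IsPseudoBasis φ p) :
    DenseRange (Finsupp.linearCombination ℝ φ) := by
  intro v
  have hmem : ∀ w : H, ‖w‖ ≤ 1 → w ∈ (LinearMap.range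
      (Finsupp.linearCombination ℝ φ)).topologicalClosure := fun w hw => by
    refine closure_mono ?_ (hφ.dense (by simpa using hw))
    rintro _ ⟨j, rfl⟩
    exact ⟨Finsupp.single j 1, by simp⟩
  rcases eq_or_ne v 0 with rfl | hv
  · exact hmem 0 (by simp)
  · have h := Submodule.smul_mem _ ‖v‖ (hmem (‖v‖⁻¹ • v) (by
      rw [norm_smul, norm_inv, norm_norm, inv_mul_cancel₀ (norm_ne_zero_iff.2 hv)]))
    rwa [smul_inv_smul₀ (norm_ne_zero_iff.2 hv)] at h

/-- A dense subset of the unit ball is norming: a strictly smaller bound on the `φ j` would pass to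
the closure and contradict the value of `‖f‖`. -/
lemma IsPseudoBasis.exists_norm_sub_le_abs_apply (hφ : IsPseudoBasis φ p) (f : StrongDual ℝ H)
    {η : ℝ} (hη : 0 < η) : ∃ j, ‖f‖ - η ≤ |f (φ j)| := by
  by_contra! hcon
  have hball : ∀ v ∈ Metric.closedBall (0 : H) 1, ‖f v‖ ≤ ‖f‖ - η := fun v hv =>
    closure_minimal (s := Set.range φ) (t := {v | ‖f v‖ ≤ ‖f‖ - η})
      (by rintro _ ⟨j, rfl⟩; exact (hcon j).le) (isClosed_le (by fun_prop) (by fun_prop))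
      (hφ.dense hv)
  have h0 : 0 ≤ ‖f‖ - η := (abs_nonneg _).trans (hcon 0).le
  have h1 := f.opNorm_le_of_unit_norm h0 fun v hv => hball v (by simp [hv])
  linarith

end PseudoBasis

/-! ### The dual-valued path. -/

section DualPath

variable {H : Type*} [NormedAddCommGroup H] [NormedSpace ℝ H] {φ : ℕ → H} {p : ℕ → H → ℝ}
  {y : ℕ → ℝ≥0 → ℝ} {ystar : ℝ≥0 → StrongDual ℝ H}

/-- The weighted increments of `y` up to time `T` are bounded by `K` whenever the weights are
unit-bounded linear combinations of the `φ j`. -/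
def IncrementBound (φ : ℕ → H) (y : ℕ → ℝ≥0 → ℝ) (T : ℝ≥0) (K : ℝ) : Prop :=
  ∀ (m N : ℕ) (u : ℕ → ℝ≥0) (c : ℕ → ℕ → ℝ), Monotone u → (∀ i, u i ≤ T) →
    (∀ i < m, ‖∑ j ∈ Finset.range N, c i j • φ j‖ ≤ 1) →
    |∑ j ∈ Finset.range N, ∑ i ∈ Finset.range m, c i j * (y j (u (i + 1)) - y j (u i))| ≤ K

lemma IncrementBound.abs_sum_le {T : ℝ≥0} {K : ℝ} (hK : IncrementBound φ y T K)
    (h0 : ∀ j, y j 0 = 0) {t : ℝ≥0} (ht : t ≤ T) (c : ℕ → ℝ) (N : ℕ) :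
    |∑ j ∈ Finset.range N, c j * y j t| ≤ K * ‖∑ j ∈ Finset.range N, c j • φ j‖ := by
  -- The norm may vanish, so the weights are normalised by a larger `r`, which then decreases to the
  -- norm.
  have key : ∀ r : ℝ, ‖∑ j ∈ Finset.range N, c j • φ j‖ < r →
      |∑ j ∈ Finset.range N, c j * y j t| ≤ K * r := by
    intro r hr
    have hr0 : 0 < r := (norm_nonneg _).trans_lt hr
    have h := hK 1 N (fun i => if i = 0 then 0 else t) (fun _ j => r⁻¹ * c j)
      (monotone_nat_of_le_succ fun i => by rcases i with _ | i <;> simp)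
      (fun i => by split_ifs <;> simp [ht]) (fun i _ => by
        simp only [mul_smul]
        rw [← Finset.smul_sum, norm_smul, norm_inv, Real.norm_of_nonneg hr0.le,
          inv_mul_le_iff₀ hr0, mul_one]
        exact hr.le)
    simp only [Finset.range_one, Finset.sum_singleton, zero_add, one_ne_zero, if_false, if_true,
      h0, sub_zero, mul_assoc] at h
    rw [← Finset.mul_sum, abs_mul, abs_inv, abs_of_pos hr0, inv_mul_le_iff₀ hr0] at h
    rwa [mul_comm]
  have hlim : Tendsto (fun r : ℝ => K * r) (𝓝[>] ‖∑ j ∈ Finset.range N, c j • φ j‖)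
      (𝓝 (K * ‖∑ j ∈ Finset.range N, c j • φ j‖)) :=
    ((continuous_const.mul continuous_id).tendsto _).mono_left nhdsWithin_le_nhds
  refine ge_of_tendsto hlim ?_
  filter_upwards [self_mem_nhdsWithin] with r hr using key r hr

/-- The `φ j` may be linearly dependent; this inequality makes `φ j ↦ y j t` well defined and
bounded on their span. -/
lemma IncrementBound.norm_linearCombination_le {T : ℝ≥0} {K : ℝ} (hK : IncrementBound φ y T K)
    (h0 : ∀ j, y j 0 = 0) {t : ℝ≥0} (ht : t ≤ T) (f : ℕ →₀ ℝ) :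
    ‖Finsupp.linearCombination ℝ (fun j => y j t) f‖ ≤ K * ‖Finsupp.linearCombination ℝ φ f‖ := by
  have hsub : f.support ⊆ Finset.range (f.support.sup id + 1) := fun j hj => by
    have : j ≤ f.support.sup id := Finset.le_sup (f := id) hj
    simpa using Nat.lt_succ_of_le this
  rw [Finsupp.linearCombination_apply, Finsupp.linearCombination_apply,
    Finsupp.sum_of_support_subset _ hsub _ (by simp),
    Finsupp.sum_of_support_subset _ hsub _ (by simp)]
  exact hK.abs_sum_le h0 ht f _

lemma IsPseudoBasis.exists_dual_path (hφ : IsPseudoBasis φ p) (h0 : ∀ j, y j 0 = 0)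
    (hK : ∀ T, ∃ K, 0 ≤ K ∧ IncrementBound φ y T K) :
    ∃ ystar : ℝ≥0 → StrongDual ℝ H, (∀ t j, ystar t (φ j) = y j t) ∧
      ∀ T K, 0 ≤ K → IncrementBound φ y T K → ∀ t ≤ T, ‖ystar t‖ ≤ K := by
  -- The extension depends on `t` alone, so a bound valid up to any `T ≥ t` applies to it.
  refine ⟨fun t => (Finsupp.linearCombination ℝ (fun j => y j t)).extendOfNorm
    (Finsupp.linearCombination ℝ φ), fun t j => ?_, fun T K hK0 hKT t ht => ?_⟩
  · obtain ⟨K, -, hKt⟩ := hK t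
    have h := LinearMap.extendOfNorm_eq hφ.denseRange_linearCombination
      ⟨K, hKt.norm_linearCombination_le h0 le_rfl⟩ (Finsupp.single j 1)
    simpa using h
  · exact LinearMap.opNorm_extendOfNorm_le hφ.denseRange_linearCombination hK0
      (hKT.norm_linearCombination_le h0 ht)

lemma dual_apply_sum (hy : ∀ t j, ystar t (φ j) = y j t) (t : ℝ≥0) (c : ℕ → ℝ) (s : Finset ℕ) :
    ystar t (∑ j ∈ s, c j • φ j) = ∑ j ∈ s, y j t * c j := by
  simp [map_sum, hy, mul_comm]

/-- Each block is `ystar t` applied to a block of the series of `h`: the norm bound gives uniformity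
in `t`, the `ℓ¹` tails uniformity in `h`. Dividing by `K + 1` covers `K = 0`. -/
lemma IsPseudoBasis.tendsto_iSup_enorm_sum_Icc (hφ : IsPseudoBasis φ p)
    (hy : ∀ t j, ystar t (φ j) = y j t) {T : ℝ≥0} {K : ℝ} (hK : ∀ t ≤ T, ‖ystar t‖ ≤ K)
    {C : Set H} (hC : IsCompact C) :
    Tendsto (fun MN : ℕ × ℕ =>
      ⨆ t ≤ T, ⨆ h ∈ C, ‖∑ j ∈ Finset.Icc MN.1 MN.2, y j t * p j h‖ₑ) atTop (𝓝 0) := by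
  have hK0 : 0 ≤ K := (norm_nonneg _).trans (hK T le_rfl)
  rw [ENNReal.tendsto_nhds_zero]
  intro ε hε
  obtain ⟨r, hr0, hrε⟩ := ENNReal.lt_iff_exists_nnreal_btwn.1 hε
  have hr : (0 : ℝ) < r := by exact_mod_cast hr0
  obtain ⟨M₀, hM₀⟩ := hφ.exists_tail_lt hC (ε := r / (K + 1)) (by positivity)
  filter_upwards [(tendsto_fst (f := atTop (α := ℕ)) (g := atTop (α := ℕ))).eventually_ge_atTop M₀
    |>.filter_mono (prod_atTop_atTop_eq.symm.le)] with MN hMN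
  refine iSup₂_le fun t ht => iSup₂_le fun h hh => le_trans ?_ hrε.le
  rw [← dual_apply_sum hy, enorm_le_coe, ← NNReal.coe_le_coe, coe_nnnorm]
  have htail := hM₀ h hh (Finset.Icc MN.1 MN.2) fun j hj => hMN.trans (Finset.mem_Icc.1 hj).1
  calc ‖ystar t (∑ j ∈ Finset.Icc MN.1 MN.2, p j h • φ j)‖
      ≤ K * (r / (K + 1)) := (ystar t).le_of_opNorm_le_of_le (hK t ht)
        ((hφ.norm_sum_le h _).trans htail.le)
    _ ≤ r := by
      rw [mul_div_assoc', div_le_iff₀ (by positivity)]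
      nlinarith

lemma IsPseudoBasis.tendstoUniformlyOn_sum_mul (hφ : IsPseudoBasis φ p)
    (hy : ∀ t j, ystar t (φ j) = y j t) {T : ℝ≥0} {K : ℝ} (hK : ∀ t ≤ T, ‖ystar t‖ ≤ K)
    {C : Set H} (hC : IsCompact C) :
    TendstoUniformlyOn (fun (N : ℕ) (q : ℝ≥0 × H) => ∑ j ∈ Finset.range N, y j q.1 * p j q.2)
      (fun q => ystar q.1 q.2) atTop (Set.Iic T ×ˢ C) := by
  have hK0 : 0 ≤ K := (norm_nonneg _).trans (hK T le_rfl)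
  rw [Metric.tendstoUniformlyOn_iff]
  intro ε hε
  filter_upwards [Metric.tendstoUniformlyOn_iff.1 (hφ.tendstoUniformlyOn hC) (ε / (K + 1))
    (by positivity)] with N hN q hq
  have h1 := hN q.2 hq.2
  rw [dist_eq_norm] at h1 ⊢
  rw [← dual_apply_sum hy, ← map_sub]
  refine lt_of_le_of_lt ((ystar q.1).le_of_opNorm_le_of_le (hK q.1 hq.1) h1.le) ?_
  rw [mul_div_assoc', div_lt_iff₀ (by positivity)]
  nlinarith

/-- On each interval the weight is a sign times a single `φ (k i)` that nearly norms the increment,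
so the weighted sum is almost the variation sum. -/
lemma IsPseudoBasis.boundedVariationOn_dual_path (hφ : IsPseudoBasis φ p)
    (hy : ∀ t j, ystar t (φ j) = y j t) {T : ℝ≥0} {K : ℝ} (hK : IncrementBound φ y T K) :
    BoundedVariationOn ystar (Set.Icc 0 T) := by
  refine ne_top_of_le_ne_top ENNReal.ofReal_ne_top (iSup_le ?_ : _ ≤ ENNReal.ofReal K)
  rintro ⟨m, u, hu, huT⟩
  simp only [edist_dist]
  rw [← ENNReal.ofReal_sum_of_nonneg fun _ _ => dist_nonneg]
  refine ENNReal.ofReal_le_ofReal (le_of_forall_pos_le_add fun η hη => ?_)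
  -- The `m` norming errors then add up to at most `η`.
  have hη' : 0 < η / (m + 1) := by positivity
  choose k hk using fun i => hφ.exists_norm_sub_le_abs_apply (ystar (u (i + 1)) - ystar (u i)) hη'
  set N := (Finset.range m).sup k + 1
  have hkN : ∀ i < m, k i ∈ Finset.range N := fun i hi =>
    Finset.mem_range.2 (Nat.lt_succ_of_le (Finset.le_sup (Finset.mem_range.2 hi)))
  set σ : ℕ → ℝ := fun i => SignType.sign ((ystar (u (i + 1)) - ystar (u i)) (φ (k i)))
  have hσ : ∀ i, |σ i| ≤ 1 := fun i => by
    simp only [σ]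
    rcases SignType.sign ((ystar (u (i + 1)) - ystar (u i)) (φ (k i))) with _ | _ | _ <;> simp
  have h := hK m N u (fun i j => if j = k i then σ i else 0) hu (fun i => (huT i).2) fun i hi => by
    simp only [ite_smul, zero_smul, Finset.sum_ite_eq', hkN i hi, if_true, norm_smul,
      Real.norm_eq_abs]
    exact mul_le_one₀ (hσ i) (norm_nonneg _) (hφ.norm_le_one _)
  have hval : ∀ i ∈ Finset.range m, ∑ j ∈ Finset.range N, (if j = k i then σ i else 0) *
      (y j (u (i + 1)) - y j (u i)) = |(ystar (u (i + 1)) - ystar (u i)) (φ (k i))| := by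
    intro i hi
    simp only [ite_mul, zero_mul, Finset.sum_ite_eq', hkN i (Finset.mem_range.1 hi), if_true]
    rw [← sign_mul_self, sub_apply, hy, hy]
    simp only [σ, sub_apply, hy]
  rw [Finset.sum_comm, Finset.sum_congr rfl hval] at h
  calc ∑ i ∈ Finset.range m, dist (ystar (u (i + 1))) (ystar (u i))
      ≤ ∑ i ∈ Finset.range m,
        (|(ystar (u (i + 1)) - ystar (u i)) (φ (k i))| + η / (m + 1)) := by
        refine Finset.sum_le_sum fun i _ => ?_
        rw [dist_eq_norm]
        linarith [hk i]
    _ ≤ K + η := by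
        rw [Finset.sum_add_distrib, Finset.sum_const, Finset.card_range, nsmul_eq_mul]
        have : (m : ℝ) * (η / (m + 1)) ≤ η := by
          rw [mul_div_assoc', div_le_iff₀ (by positivity)]
          nlinarith
        linarith [(le_abs_self _).trans h]

end DualPath

/-! ### The theorem. -/

theorem theorem4p9 {H : Type*} [NormedAddCommGroup H] [NormedSpace ℝ H] [CompleteSpace H]
    [TopologicalSpace.SeparableSpace H]
    {Ω : ℕ → Type*} [mΩ : ∀ n, MeasurableSpace (Ω n)]
    (P : ∀ n, Measure (Ω n)) [∀ n, IsProbabilityMeasure (P n)]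
    (F : ∀ n, Filtration ℝ≥0 (mΩ n)) [∀ n, (F n).IsRightContinuous]
    (X : ∀ n, ℝ≥0 → Ω n → H) (hX : ∀ n ω, IsCadlag fun t => X n t ω)
    (hXadapted : ∀ n, StronglyAdapted (F n) (X n))
    (Y : ∀ n, H → ℝ≥0 → Ω n → ℝ) (hY : IsUniformlyExponentiallyTight P F Y)
    (φ : ℕ → H) (p : ℕ → H → ℝ) (hφ : IsPseudoBasis φ p)
    (I : CadlagPath (H × (ℕ → ℝ)) → ℝ≥0∞)
    (hI : SatisfiesLDP P
      (fun n ω => jointPath (fun t => X n t ω) (hX n ω) (fun j t => Y n (φ j) t ω)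
        (fun j => (hY.standard n).cadlag (φ j) ω)) I)
    (x : ℝ≥0 → H) (hx : IsCadlag x) (y : ℕ → ℝ≥0 → ℝ) (hy : ∀ j, IsCadlag (y j))
    (hxy : I (jointPath x hx y hy) < ∞) :
    (∀ C : Set H, IsCompact C → ∀ T : ℝ≥0,
      Tendsto (fun MN : ℕ × ℕ =>
        ⨆ t ≤ T, ⨆ h ∈ C, ‖∑ j ∈ Finset.Icc MN.1 MN.2, y j t * p j h‖ₑ) atTop (𝓝 0)) ∧
    ∃ ystar : ℝ≥0 → StrongDual ℝ H,
      (∀ C : Set H, IsCompact C → ∀ T : ℝ≥0,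
        TendstoUniformlyOn (fun (N : ℕ) (q : ℝ≥0 × H) => ∑ j ∈ Finset.range N, y j q.1 * p j q.2)
          (fun q => ystar q.1 q.2) atTop (Set.Iic T ×ˢ C)) ∧
      ∀ t : ℝ≥0, BoundedVariationOn ystar (Set.Icc 0 t) := by
  have h0 : ∀ j, y j 0 = 0 := eq_zero_of_rate_lt_top hY hI hxy
  have hK : ∀ T, ∃ K, 0 ≤ K ∧ IncrementBound φ y T K := exists_abs_sum_increments_le hY hI hxy
  obtain ⟨ystar, hy, hbound⟩ := hφ.exists_dual_path h0 hK
  refine ⟨fun C hC T => ?_, ystar, fun C hC T => ?_, fun t => ?_⟩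
  · obtain ⟨K, hK0, hKT⟩ := hK T
    exact hφ.tendsto_iSup_enorm_sum_Icc hy (hbound T K hK0 hKT) hC
  · obtain ⟨K, hK0, hKT⟩ := hK T
    exact hφ.tendstoUniformlyOn_sum_mul hy (hbound T K hK0 hKT) hC
  · obtain ⟨K, -, hKt⟩ := hK t
    exact hφ.boundedVariationOn_dual_path hy hKt
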